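/- Let $\mathcal P$ be the plane $\mathbb R^2$ with a norm whose unit circle is a smooth, quadratically convex (smooth with nowhere vanishing Euclidean curvature) closed curve, symmetric about the origin. Write $[x,y]$ for the determinant of two vectors, $e(\varphi)=(\cos\varphi,\sin\varphi)$, and let $p:\mathbb R\to\mathbb R^2$ be the smooth parametrization of the unit circle by its tangent angle: $p'(\varphi)$ is a positive multiple of $e(\varphi)$, $p(\varphi+\pi)=-p(\varphi)$, and $[p,p']>0$. Let $q=p'/[p,p']$ be the dual parametrization. The class $\mathcal H$ consists of the smooth (possibly singular) plane curves $\gamma$ together with a smooth angle function $\theta$ such that $[e(\theta(t)),\gamma'(t)]=0$ and $\theta'(t)\neq0$ for all $t$, i.e. fronts whose Legendrian lift $\nu(t)=\mathbb R\,e(\theta(t))\in \mathrm P\mathbb R^1$ is immersed. Such a curve is closed if, for some $T>0$, $\gamma(t+T)=\gamma(t)$ and $|\theta(t+T)-\theta(t)|=2\pi$ for all $t$ (it closes after one full turn of its tangent). Its support function is $h(t)=[\gamma(t),q(\theta(t))]$, and $\gamma$ has constant width if there is a constant $c$ with $h(s)+h(t)=c$ whenever $\theta(t)=\theta(s)+\pi$;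 when $\theta$ is used as the parameter, this reads $h(\theta)+h(\theta+\pi)=c$. The curvature radius $r$ of $\gamma$ is defined by $\gamma'(t)=r(t)\,\frac{d}{dt}\,p(\theta(t))$, and a vertex of $\gamma$ is a parameter value $t$ with $r'(t)=0$. **Theorem (six vertices theorem).** Let $\gamma\in\mathcal H$ be a closed curve with constant width. Then its curvature radius $r$ is a well-defined smooth function and $\gamma$ has at least six vertices, i.e. there are at least six distinct $t\in[0,T)$ with $r'(t)=0$. -/

import Mathlib

open scoped ContDiff

noncomputable section

namespace NormedPlane

/-- The determinant `[x, y]` of a pair of vectors of the plane. -/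
def det (x y : ℝ × ℝ) : ℝ := x.1 * y.2 - x.2 * y.1

/-- The Euclidean unit vector making the angle `φ` with the first coordinate axis. -/
def dir (φ : ℝ) : ℝ × ℝ := (Real.cos φ, Real.sin φ)

/-- `N` is a norm on the plane whose unit circle is smooth, quadratically convex and symmetric,
and `p` is the parametrization of this unit circle by the angle `φ` that its tangent makes with
the first axis.  That the derivative of `p` with respect to the tangent angle exists and does not
vanish says that the unit circle is smooth with nowhere vanishing Euclidean curvature. -/
structure IsUnitCircle (N : Seminorm ℝ (ℝ × ℝ)) (p : ℝ → ℝ × ℝ) : Prop where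
  definite : ∀ x, N x = 0 → x = 0
  smooth : ContDiff ℝ ∞ p
  range_eq : Set.range p = {x | N x = 1}
  antipodal : ∀ φ, p (φ + Real.pi) = -p φ
  tangent : ∀ φ, ∃ ρ : ℝ, 0 < ρ ∧ deriv p φ = ρ • dir φ
  counterclockwise : ∀ φ, 0 < det (p φ) (deriv p φ)

/-- The dual parametrization `q = p' / [p, p']`. -/
def dualParam (p : ℝ → ℝ × ℝ) (φ : ℝ) : ℝ × ℝ :=
  (det (p φ) (deriv p φ))⁻¹ • deriv p φ

/-- `γ` is a front without inflections (a member of the class `ℋ`).  The Legendrian lift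
`ν : ℝ → P ℝ¹` is given by a smooth angle function `θ`, that is, `ν t` is the line spanned by
`dir (θ t)`; it satisfies `[ν, γ'] = 0` and `ν' ≠ 0`.  The curve `γ` may be singular. -/
structure IsFront (γ : ℝ → ℝ × ℝ) (θ : ℝ → ℝ) : Prop where
  smooth : ContDiff ℝ ∞ γ
  smooth_angle : ContDiff ℝ ∞ θ
  legendrian : ∀ t, det (dir (θ t)) (deriv γ t) = 0
  angle_deriv_ne_zero : ∀ t, deriv θ t ≠ 0

/-- The front `γ` closes up, with period `T`, after one full turn (in either direction) of its
tangent line. -/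
structure IsClosedFront (γ : ℝ → ℝ × ℝ) (θ : ℝ → ℝ) (T : ℝ) : Prop extends IsFront γ θ where
  period_pos : 0 < T
  periodic : Function.Periodic γ T
  one_turn : ∀ t, |θ (t + T) - θ t| = 2 * Real.pi

/-- The support function `h = [γ, q]`. -/
def supportFunction (p : ℝ → ℝ × ℝ) (γ : ℝ → ℝ × ℝ) (θ : ℝ → ℝ) (t : ℝ) : ℝ :=
  det (γ t) (dualParam p (θ t))

/-- Constant width: the sum of the values of the support function at two points with opposite
tangent directions is constant.  When the curve is parametrized by the tangent angle `φ`, this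
is `h φ + h (φ + π) = c`. -/
def HasConstantWidth (p : ℝ → ℝ × ℝ) (γ : ℝ → ℝ × ℝ) (θ : ℝ → ℝ) : Prop :=
  ∃ c : ℝ, ∀ s t, θ t = θ s + Real.pi →
    supportFunction p γ θ s + supportFunction p γ θ t = c

/-- `r` is the curvature radius of `γ`: the velocity of `γ` is `r` times the velocity of the
point of the unit circle with the same tangent angle. -/
def IsCurvatureRadius (p : ℝ → ℝ × ℝ) (γ : ℝ → ℝ × ℝ) (θ : ℝ → ℝ) (r : ℝ → ℝ) : Prop :=
  ∀ t, deriv γ t = r t • deriv (fun s => p (θ s)) t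

/-- The vertices, as parameter values in one period: the zeros of the derivative of the curvature
radius `r`. -/
def vertices (r : ℝ → ℝ) (T : ℝ) : Set ℝ :=
  {t | t ∈ Set.Ico 0 T ∧ deriv r t = 0}

end NormedPlane

end

namespace NormedPlane

open Real Set

/-! ### Zeros of antiperiodic functions orthogonal to a two-dimensional Chebyshev system -/

/-! Use the tangent angle as parameter, so that `Γ' = R p'`. Constant width upgrades to a vector
identity, `Γ x - Γ (x + π) = c p x` (`sub_antipode_eq`); differentiating it gives `R x + R (x + π) =
c`, so `f = R'` is π-antiperiodic. Integrating by parts, `f` is orthogonal on every half turn `(a, a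
+ π)` to `[p a, p]`, which has no zeros there (`halfTurnOrthogonal_radius_deriv`,
`IsUnitCircle.det_ne_zero`). Hence `f` has a zero in every open half turn. If a half turn starting
at a zero held just one more zero, then `f` would keep one sign on a half turn starting at one of
the two zeros, against orthogonality. So there are three zeros per half turn, and antiperiodicity
doubles them to six. -/

theorem pos_or_neg_of_ne_zero {f : ℝ → ℝ} {s : Set ℝ} (hs : IsPreconnected s)
    (hf : ContinuousOn f s) (h0 : ∀ x ∈ s, f x ≠ 0) :
    (∀ x ∈ s, 0 < f x) ∨ (∀ x ∈ s, f x < 0) := by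
  by_contra! h
  obtain ⟨⟨x, hx, hfx⟩, ⟨y, hy, hfy⟩⟩ := h
  obtain ⟨z, hz, hz0⟩ := hs.intermediate_value hx hy hf ⟨hfx, hfy⟩
  exact h0 z hz hz0

/-- A monotone `G` with equal end values is constant: a nonnegative function of zero integral
vanishes, phrased through an antiderivative. -/
theorem eq_zero_of_deriv_nonneg {G k : ℝ → ℝ} {a b : ℝ} (hG : ∀ x, HasDerivAt G (k x) x)
    (hab : G a = G b) (hk : ∀ x ∈ Ioo a b, 0 ≤ k x) : ∀ x ∈ Ioo a b, k x = 0 := by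
  have hmono : MonotoneOn G (Icc a b) := by
    refine monotoneOn_of_deriv_nonneg (convex_Icc a b)
      (fun x _ => (hG x).continuousAt.continuousWithinAt)
      (fun x _ => (hG x).differentiableAt.differentiableWithinAt) ?_
    intro x hx
    rw [interior_Icc] at hx
    rw [(hG x).deriv]
    exact hk x hx
  intro x hx
  have hle : a ≤ b := (hx.1.trans hx.2).le
  have hc : ∀ y ∈ Icc a b, G y = G a := fun y hy =>
    le_antisymm ((hmono hy (right_mem_Icc.2 hle) hy.2).trans hab.ge)
      (hmono (left_mem_Icc.2 hle) hy hy.1)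
  have h1 : HasDerivAt G 0 x := by
    refine (hasDerivAt_const x (G a)).congr_of_eventuallyEq ?_
    filter_upwards [Icc_mem_nhds hx.1 hx.2] with y hy using hc y hy
  exact (hG x).unique h1

/-- On the half turn starting at `a`, the function `f` is orthogonal to a function without zeros.
The integral is expressed by an antiderivative `G` of the product. -/
def HalfTurnOrthogonal (f : ℝ → ℝ) (a : ℝ) : Prop :=
  ∃ G g : ℝ → ℝ, Continuous g ∧ (∀ x, HasDerivAt G (f x * g x) x) ∧ G a = G (a + π) ∧
    ∀ x ∈ Ioo a (a + π), g x ≠ 0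

theorem HalfTurnOrthogonal.neg {f : ℝ → ℝ} {a : ℝ} (h : HalfTurnOrthogonal f a) :
    HalfTurnOrthogonal (fun x => -f x) a := by
  obtain ⟨G, g, hg, hG, hGa, h0⟩ := h
  refine ⟨fun x => -G x, g, hg, fun x => ?_, by simp only [hGa], h0⟩
  exact (hG x).neg.congr_deriv (by ring)

theorem HalfTurnOrthogonal.exists_zero {f : ℝ → ℝ} {a : ℝ} (h : HalfTurnOrthogonal f a) :
    ∃ x ∈ Ioo a (a + π), f x = 0 := by
  obtain ⟨G, g, -, hG, hGa, h0⟩ := h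
  obtain ⟨x, hx, hx0⟩ := exists_hasDerivAt_eq_zero (f := G) (f' := fun x => f x * g x)
    (by linarith [pi_pos]) (fun x _ => (hG x).continuousAt.continuousWithinAt) hGa
    (fun x _ => hG x)
  exact ⟨x, hx, (mul_eq_zero.1 hx0).resolve_right (h0 x hx)⟩

theorem HalfTurnOrthogonal.eq_zero_of_nonneg {f : ℝ → ℝ} {a : ℝ} (h : HalfTurnOrthogonal f a)
    (hf : ∀ x ∈ Ioo a (a + π), 0 ≤ f x) : ∀ x ∈ Ioo a (a + π), f x = 0 := by
  obtain ⟨G, g, hg, hG, hGa, h0⟩ := h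
  rcases pos_or_neg_of_ne_zero isPreconnected_Ioo hg.continuousOn h0 with hs | hs
  · intro x hx
    have := eq_zero_of_deriv_nonneg hG hGa (fun y hy => mul_nonneg (hf y hy) (hs y hy).le) x hx
    exact (mul_eq_zero.1 this).resolve_right (h0 x hx)
  · intro x hx
    have := eq_zero_of_deriv_nonneg (G := fun x => -G x) (fun y => (hG y).neg)
      (by simp only [hGa])
      (fun y hy => neg_nonneg.2 (mul_nonpos_of_nonneg_of_nonpos (hf y hy) (hs y hy).le)) x hx
    exact (mul_eq_zero.1 (neg_eq_zero.1 this)).resolve_right (h0 x hx)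

/-- If `f` has no zeros in the half turn other than `a` and `b`, it is not positive between
them. -/
theorem exists_third_zero_of_pos {f : ℝ → ℝ} (hf : Continuous f) (ha : f.Antiperiodic π)
    (ho : ∀ a, HalfTurnOrthogonal f a) {a b : ℝ} (hb : b ∈ Ioo a (a + π)) (hfa : f a = 0)
    (hfb : f b = 0) (hpos : ∀ x ∈ Ioo a b, 0 < f x) : ∃ c ∈ Ioo b (a + π), f c = 0 := by
  by_contra! h
  obtain ⟨hab, hba⟩ := hb
  rcases pos_or_neg_of_ne_zero isPreconnected_Ioo hf.continuousOn h with hs | hs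
  -- No sign change at `b`: `f` is nonnegative on the half turn from `a`.
  · have := (ho a).eq_zero_of_nonneg (fun x hx => by
      rcases lt_trichotomy x b with hx' | rfl | hx'
      · exact (hpos x ⟨hx.1, hx'⟩).le
      · exact hfb.ge
      · exact (hs x ⟨hx', hx.2⟩).le) ((a + b) / 2) ⟨by linarith, by linarith⟩
    exact (hpos ((a + b) / 2) ⟨by linarith, by linarith⟩).ne' this
  -- Sign change at `b`: by antiperiodicity `f` is also negative on `(a + π, b + π)`, hence
  -- nonpositive on the half turn from `b`.
  · have := (ho b).neg.eq_zero_of_nonneg (fun x hx => by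
      rw [neg_nonneg]
      rcases lt_trichotomy x (a + π) with hx' | rfl | hx'
      · exact (hs x ⟨hx.1, hx'⟩).le
      · rw [ha a, hfa, neg_zero]
      · have h1 := ha (x - π)
        rw [sub_add_cancel] at h1
        rw [h1, neg_nonpos]
        exact (hpos (x - π) ⟨by linarith, by linarith [hx.2]⟩).le)
      ((b + (a + π)) / 2) ⟨by linarith, by linarith⟩
    exact h ((b + (a + π)) / 2) ⟨by linarith, by linarith⟩ (neg_eq_zero.1 this)

theorem exists_three_zeros {f : ℝ → ℝ} (hf : Continuous f) (ha : f.Antiperiodic π)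
    (ho : ∀ a, HalfTurnOrthogonal f a) :
    ∃ a b c, a < b ∧ b < c ∧ c < a + π ∧ f a = 0 ∧ f b = 0 ∧ f c = 0 := by
  obtain ⟨a, -, hfa⟩ := (ho 0).exists_zero
  obtain ⟨b, hb, hfb⟩ := (ho a).exists_zero
  by_cases h : ∃ x ∈ Ioo a b, f x = 0
  · obtain ⟨x, hx, hfx⟩ := h
    exact ⟨a, x, b, hx.1, hx.2, hb.2, hfa, hfx, hfb⟩
  push Not at h
  have key : ∃ c ∈ Ioo b (a + π), f c = 0 := by
    rcases pos_or_neg_of_ne_zero isPreconnected_Ioo hf.continuousOn h with hs | hs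
    · exact exists_third_zero_of_pos hf ha ho hb hfa hfb hs
    · obtain ⟨c, hc, hfc⟩ := exists_third_zero_of_pos (f := fun x => -f x) hf.neg
        (fun x => by simp only [ha x]) (fun a => (ho a).neg) hb (by simp [hfa]) (by simp [hfb])
        (fun x hx => neg_pos.2 (hs x hx))
      exact ⟨c, hc, neg_eq_zero.1 hfc⟩
  obtain ⟨c, hc, hfc⟩ := key
  exact ⟨a, b, c, hb.1, hc.1, hc.2, hfa, hfb, hfc⟩

theorem exists_six_zeros {f : ℝ → ℝ} (hf : Continuous f) (ha : f.Antiperiodic π)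
    (ho : ∀ a, HalfTurnOrthogonal f a) :
    ∃ a, 6 ≤ {x | x ∈ Ico a (a + 2 * π) ∧ f x = 0}.encard := by
  obtain ⟨a, b, c, hab, hbc, hca, hfa, hfb, hfc⟩ := exists_three_zeros hf ha ho
  have hpi := pi_pos
  refine ⟨a, ?_⟩
  let s : Finset ℝ := {a, b, c, a + π, b + π, c + π}
  have hs : s.card = 6 := by
    rw [Finset.card_insert_of_notMem, Finset.card_insert_of_notMem,
      Finset.card_insert_of_notMem, Finset.card_insert_of_notMem, Finset.card_pair]
    · exact (by linarith : b + π < c + π).ne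
    all_goals
      simp only [Finset.mem_insert, Finset.mem_singleton, not_or]
      repeat' constructor
      all_goals exact ne_of_lt (by linarith)
  calc (6 : ℕ∞) = (s : Set ℝ).encard := by rw [Set.encard_coe_eq_coe_finsetCard, hs]; rfl
    _ ≤ _ := by
      refine Set.encard_le_encard ?_
      intro x hx
      simp only [s, Finset.coe_insert, Finset.coe_singleton, mem_insert_iff,
        mem_singleton_iff] at hx
      rcases hx with rfl | rfl | rfl | rfl | rfl | rfl
      · exact ⟨⟨by linarith, by linarith⟩, hfa⟩
      · exact ⟨⟨by linarith, by linarith⟩, hfb⟩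
      · exact ⟨⟨by linarith, by linarith⟩, hfc⟩
      · exact ⟨⟨by linarith, by linarith⟩, by rw [ha, hfa, neg_zero]⟩
      · exact ⟨⟨by linarith, by linarith⟩, by rw [ha, hfb, neg_zero]⟩
      · exact ⟨⟨by linarith, by linarith⟩, by rw [ha, hfc, neg_zero]⟩

/-! ### The determinant and the unit circle -/

theorem hasDerivAt_det {u v : ℝ → ℝ × ℝ} {u' v' : ℝ × ℝ} {x : ℝ} (hu : HasDerivAt u u' x)
    (hv : HasDerivAt v v' x) :
    HasDerivAt (fun y => NormedPlane.det (u y) (v y))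
      (NormedPlane.det u' (v x) + NormedPlane.det (u x) v') x := by
  have hu1 : HasDerivAt (fun y => (u y).1) u'.1 x := hu.fst
  have hu2 : HasDerivAt (fun y => (u y).2) u'.2 x := hu.snd
  have hv1 : HasDerivAt (fun y => (v y).1) v'.1 x := hv.fst
  have hv2 : HasDerivAt (fun y => (v y).2) v'.2 x := hv.snd
  refine ((hu1.mul hv2).sub (hu2.mul hv1)).congr_deriv ?_
  simp only [NormedPlane.det]; ring

theorem hasDerivAt_dir (x : ℝ) : HasDerivAt dir (dir (x + π / 2)) x := by
  refine ((hasDerivAt_cos x).prodMk (hasDerivAt_sin x)).congr_deriv ?_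
  simp [dir, cos_add_pi_div_two, sin_add_pi_div_two]

theorem eq_zero_of_det_dir_eq_zero {v : ℝ × ℝ} {x y : ℝ} (hx : det v (dir x) = 0)
    (hy : det v (dir y) = 0) (hxy : sin (y - x) ≠ 0) : v = 0 := by
  simp only [det, dir] at hx hy
  rw [sin_sub] at hxy
  ext
  · refine (mul_eq_zero.1 (?_ : v.1 * _ = 0)).resolve_right hxy
    linear_combination cos x * hy - cos y * hx
  · refine (mul_eq_zero.1 (?_ : v.2 * _ = 0)).resolve_right hxy
    linear_combination sin x * hy - sin y * hx

namespace IsUnitCircle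

variable {N : Seminorm ℝ (ℝ × ℝ)} {p : ℝ → ℝ × ℝ}

theorem hasDerivAt (hp : IsUnitCircle N p) (x : ℝ) : HasDerivAt p (deriv p x) x :=
  (hp.smooth.differentiable (by simp) x).hasDerivAt

theorem ne_zero (hp : IsUnitCircle N p) (x : ℝ) : p x ≠ 0 := by
  intro h
  have := hp.counterclockwise x
  simp [det, h] at this

theorem deriv_ne_zero (hp : IsUnitCircle N p) (x : ℝ) : deriv p x ≠ 0 := by
  intro h
  have := hp.counterclockwise x
  simp [det, h] at this

theorem deriv_add_pi (hp : IsUnitCircle N p) (x : ℝ) : deriv p (x + π) = -deriv p x := by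
  rw [← deriv_comp_add_const, funext hp.antipodal, deriv.fun_neg]

theorem det_dir_of_det_deriv (hp : IsUnitCircle N p) {v : ℝ × ℝ} {x : ℝ}
    (h : det v (deriv p x) = 0) : det v (dir x) = 0 := by
  obtain ⟨ρ, hρ, h1⟩ := hp.tangent x
  refine (mul_eq_zero.1 (?_ : ρ * _ = 0)).resolve_left hρ.ne'
  rw [← h, h1]
  simp only [det, Prod.smul_fst, Prod.smul_snd, smul_eq_mul]; ring

/-- Otherwise Rolle's theorem on `(a, x)` and on `(x, a + π)` gives two tangent directions, at
angles less than `π` apart, both parallel to `p a`, which forces `p a = 0`. -/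
theorem det_ne_zero (hp : IsUnitCircle N p) {a x : ℝ} (hx : x ∈ Ioo a (a + π)) :
    det (p a) (p x) ≠ 0 := by
  intro h0
  have hd (y : ℝ) : HasDerivAt (fun y => det (p a) (p y)) (det (p a) (deriv p y)) y := by
    refine (hasDerivAt_det (hasDerivAt_const y (p a)) (hp.hasDerivAt y)).congr_deriv ?_
    simp [det]
  have rolle {b c : ℝ} (hbc : b < c) (hb : det (p a) (p b) = 0) (hc : det (p a) (p c) = 0) :
      ∃ y ∈ Ioo b c, det (p a) (dir y) = 0 := by
    obtain ⟨y, hy, hy0⟩ := exists_hasDerivAt_eq_zero hbc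
      (fun x _ => (hd x).continuousAt.continuousWithinAt) (hb.trans hc.symm) (fun x _ => hd x)
    exact ⟨y, hy, hp.det_dir_of_det_deriv hy0⟩
  obtain ⟨y, hy, hy0⟩ := rolle hx.1 (by simp only [det]; ring) h0
  obtain ⟨z, hz, hz0⟩ := rolle hx.2 h0 (by
    rw [hp.antipodal]
    simp only [det, Prod.fst_neg, Prod.snd_neg]
    ring)
  refine hp.ne_zero a (eq_zero_of_det_dir_eq_zero hy0 hz0 (sin_pos_of_pos_of_lt_pi ?_ ?_).ne')
  · linarith [hy.2, hz.1]
  · linarith [hy.1, hz.2]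

end IsUnitCircle

/-! ### Curves of constant width parametrized by the tangent angle -/

section AngleParam

variable {N : Seminorm ℝ (ℝ × ℝ)} {p Γ : ℝ → ℝ × ℝ} {R f : ℝ → ℝ} {c : ℝ}

/-- The defect `E` of the identity is parallel to `dir x` by constant width, and so is `E'`.
Differentiating `[E, dir] = 0` therefore leaves `[E, dir (x + π / 2)] = 0`, and `E` is parallel to
two independent directions. -/
theorem sub_antipode_eq (hp : IsUnitCircle N p) (hΓ : ∀ x, HasDerivAt Γ (R x • deriv p x) x)
    (hc : ∀ x, det (Γ x) (dualParam p x) + det (Γ (x + π)) (dualParam p (x + π)) = c) (x : ℝ) :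
    Γ x - Γ (x + π) = c • p x := by
  let E : ℝ → ℝ × ℝ := fun x => Γ x - Γ (x + π) - c • p x
  have hE (x : ℝ) : HasDerivAt E ((R x + R (x + π) - c) • deriv p x) x := by
    refine (((hΓ x).sub ((hΓ (x + π)).comp_add_const x π)).sub
      ((hp.hasDerivAt x).const_smul c)).congr_deriv ?_
    rw [hp.deriv_add_pi]
    module
  have h1 (x : ℝ) : det (E x) (dir x) = 0 := by
    refine hp.det_dir_of_det_deriv ?_
    have h2 := hc x
    have h3 := (hp.counterclockwise x).ne'
    simp only [dualParam, hp.deriv_add_pi, hp.antipodal] at h2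
    simp only [E]
    simp only [det, Prod.fst_neg, Prod.snd_neg, Prod.smul_fst, Prod.smul_snd, smul_eq_mul,
      Prod.fst_sub, Prod.snd_sub] at h2 h3 ⊢
    rw [neg_mul_neg, neg_mul_neg] at h2
    field_simp at h2
    linear_combination h2
  have h2 : det (E x) (dir (x + π / 2)) = 0 := by
    have h3 := hasDerivAt_det (hE x) (hasDerivAt_dir x)
    have h4 := h3.unique ((hasDerivAt_const x (0 : ℝ)).congr_of_eventuallyEq
      (Filter.Eventually.of_forall h1))
    obtain ⟨ρ, -, h5⟩ := hp.tangent x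
    rw [h5] at h4
    rw [← h4]
    simp only [det, Prod.smul_fst, Prod.smul_snd, smul_eq_mul]; ring
  have := eq_zero_of_det_dir_eq_zero (h1 x) h2 (by simp)
  exact sub_eq_zero.1 this

theorem radius_add_radius_eq (hp : IsUnitCircle N p)
    (hΓ : ∀ x, HasDerivAt Γ (R x • deriv p x) x)
    (hc : ∀ x, Γ x - Γ (x + π) = c • p x) (x : ℝ) : R x + R (x + π) = c := by
  have h1 := (hΓ x).sub ((hΓ (x + π)).comp_add_const x π)
  have h2 := h1.unique (((hp.hasDerivAt x).const_smul c).congr_of_eventuallyEq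
    (Filter.Eventually.of_forall hc))
  rw [hp.deriv_add_pi] at h2
  exact smul_left_injective ℝ (hp.deriv_ne_zero x)
    (show (R x + R (x + π)) • deriv p x = c • deriv p x by rw [← h2]; module)

theorem radius_deriv_antiperiodic (hR : ∀ x, HasDerivAt R (f x) x)
    (hc : ∀ x, R x + R (x + π) = c) : f.Antiperiodic π := by
  intro x
  have h1 := (hR x).add ((hR (x + π)).comp_add_const x π)
  have h2 := h1.unique ((hasDerivAt_const x c).congr_of_eventuallyEq
    (Filter.Eventually.of_forall hc))
  linarith

theorem halfTurnOrthogonal_radius_deriv (hp : IsUnitCircle N p)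
    (hΓ : ∀ x, HasDerivAt Γ (R x • deriv p x) x) (hR : ∀ x, HasDerivAt R (f x) x)
    (hc : ∀ x, Γ x - Γ (x + π) = c • p x) (a : ℝ) : HalfTurnOrthogonal f a := by
  have hd (x : ℝ) : HasDerivAt (fun y => det (p a) (p y)) (det (p a) (deriv p x)) x := by
    refine (hasDerivAt_det (hasDerivAt_const x (p a)) (hp.hasDerivAt x)).congr_deriv ?_
    simp [det]
  have hd' (x : ℝ) : HasDerivAt (fun y => det (p a) (Γ y)) (det (p a) (R x • deriv p x)) x := by
    refine (hasDerivAt_det (hasDerivAt_const x (p a)) (hΓ x)).congr_deriv ?_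
    simp [det]
  -- Integration by parts: `R [p a, p'] = [p a, Γ']`, so this is an antiderivative of `R' [p a, p]`.
  refine ⟨fun x => R x * det (p a) (p x) - det (p a) (Γ x), fun x => det (p a) (p x),
    continuous_iff_continuousAt.2 fun x => (hd x).continuousAt, fun x => ?_, ?_,
    fun x hx => hp.det_ne_zero hx⟩
  · refine (((hR x).mul (hd x)).sub (hd' x)).congr_deriv ?_
    simp only [det, Prod.smul_fst, Prod.smul_snd, smul_eq_mul]; ring
  -- The first term vanishes at both ends, and `Γ` changes by a multiple of `p a`, invisible to `[p
  -- a, ·]`.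
  · have h1 : Γ (a + π) = Γ a - c • p a := by rw [← hc a]; abel
    simp only [h1, hp.antipodal]
    simp only [det, Prod.fst_neg, Prod.snd_neg, Prod.smul_fst, Prod.smul_snd, smul_eq_mul,
      Prod.fst_sub, Prod.snd_sub]
    ring

end AngleParam

/-! ### The angle function of a closed front -/

section Angle

variable {θ : ℝ → ℝ}

theorem injective_of_deriv_ne_zero (hθ : Differentiable ℝ θ) (h0 : ∀ t, deriv θ t ≠ 0) :
    Function.Injective θ := by
  have key {s t : ℝ} (hst : s < t) : θ s ≠ θ t := by
    intro h
    obtain ⟨x, -, hx⟩ := exists_deriv_eq_zero hst hθ.continuous.continuousOn h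
    exact h0 x hx
  intro s t h
  rcases lt_trichotomy s t with hst | hst | hst
  · exact absurd h (key hst)
  · exact hst
  · exact absurd h.symm (key hst)

/-- A continuous injective angle is strictly monotone, so the direction of the turn is the same for
all `t`. -/
theorem exists_turning_sign {T c : ℝ} (hθ : Continuous θ) (hi : Function.Injective θ)
    (hT : 0 < T) (h : ∀ t, |θ (t + T) - θ t| = c) :
    ∃ n : ℤ, (n = 1 ∨ n = -1) ∧ ∀ t, θ (t + T) = θ t + n * c := by
  rcases hθ.strictMono_of_inj hi with hm | hm
  · refine ⟨1, Or.inl rfl, fun t => ?_⟩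
    have h1 := h t
    rw [abs_of_pos (sub_pos.2 (hm (by linarith)))] at h1
    push_cast
    linarith
  · refine ⟨-1, Or.inr rfl, fun t => ?_⟩
    have h1 := h t
    rw [abs_of_neg (sub_neg.2 (hm (by linarith)))] at h1
    push_cast
    linarith

theorem angle_add_zsmul {T d : ℝ} (h : ∀ t, θ (t + T) = θ t + d) (k : ℤ) (t : ℝ) :
    θ (t + k * T) = θ t + k * d := by
  induction k with
  | zero => simp
  | succ k ih =>
    have := h (t + k * T)
    push_cast at ih ⊢
    rw [show t + ((k : ℝ) + 1) * T = t + k * T + T by ring, this, ih]; ring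
  | pred k ih =>
    have := h (t + (-(k : ℝ) - 1) * T)
    push_cast at ih ⊢
    rw [show t + (-(k : ℝ) - 1) * T + T = t + -k * T by ring, ih] at this
    linarith

theorem surjective_of_add_eq {T d : ℝ} (hθ : Continuous θ) (hd : d ≠ 0)
    (h : ∀ t, θ (t + T) = θ t + d) : Function.Surjective θ := by
  have key (y : ℝ) : ∃ t, θ t ≤ y := by
    obtain ⟨k, hk⟩ : ∃ k : ℤ, k * d ≤ y - θ 0 := by
      rcases hd.lt_or_gt with hd | hd
      · exact ⟨⌈(y - θ 0) / d⌉, (div_le_iff_of_neg hd).1 (Int.le_ceil _)⟩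
      · exact ⟨⌊(y - θ 0) / d⌋, (le_div_iff₀ hd).1 (Int.floor_le _)⟩
    exact ⟨0 + k * T, by rw [angle_add_zsmul h]; linarith⟩
  have key' (y : ℝ) : ∃ t, y ≤ θ t := by
    obtain ⟨k, hk⟩ : ∃ k : ℤ, y - θ 0 ≤ k * d := by
      rcases hd.lt_or_gt with hd | hd
      · exact ⟨⌊(y - θ 0) / d⌋, (le_div_iff_of_neg hd).1 (Int.floor_le _)⟩
      · exact ⟨⌈(y - θ 0) / d⌉, (div_le_iff₀ hd).1 (Int.le_ceil _)⟩
    exact ⟨0 + k * T, by rw [angle_add_zsmul h]; linarith⟩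
  intro y
  obtain ⟨s, hs⟩ := key y
  obtain ⟨t, ht⟩ := key' y
  exact mem_range_of_exists_le_of_exists_ge hθ ⟨s, hs⟩ ⟨t, ht⟩

theorem exists_smooth_inverse (hθ : ContDiff ℝ ∞ θ) (h0 : ∀ t, deriv θ t ≠ 0)
    (hs : Function.Surjective θ) :
    ∃ ψ : ℝ → ℝ, (∀ t, ψ (θ t) = t) ∧ (∀ x, θ (ψ x) = x) ∧ Continuous ψ ∧
      ∀ x, HasDerivAt ψ (deriv θ (ψ x))⁻¹ x := by
  have hd : Differentiable ℝ θ := hθ.differentiable (by simp)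
  have hi := injective_of_deriv_ne_zero hd h0
  have ho : IsOpenMap θ := isOpenMap_of_hasStrictDerivAt
    (fun x => hθ.contDiffAt.hasStrictDerivAt (by simp)) h0
  let e : ℝ ≃ₜ ℝ := (Equiv.ofBijective θ ⟨hi, hs⟩).toHomeomorphOfContinuousOpen hd.continuous ho
  have hr (x : ℝ) : θ (e.symm x) = x := e.apply_symm_apply x
  refine ⟨e.symm, fun t => e.symm_apply_apply t, hr, e.symm.continuous, fun x => ?_⟩
  exact HasDerivAt.of_local_left_inverse e.symm.continuous.continuousAt (hd _).hasDerivAt (h0 _)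
    (Filter.Eventually.of_forall hr)

end Angle

/-! ### The curvature radius -/

/-- Both `γ'` and `(p ∘ θ)'` are multiples of `dir θ`, the latter nonzero; `r` is the quotient of
their components along `dir θ`. -/
theorem IsFront.exists_curvatureRadius {N : Seminorm ℝ (ℝ × ℝ)} {p γ : ℝ → ℝ × ℝ} {θ : ℝ → ℝ}
    (hp : IsUnitCircle N p) (hγ : IsFront γ θ) :
    ∃ r : ℝ → ℝ, ContDiff ℝ ∞ r ∧ IsCurvatureRadius p γ θ r := by
  have hp' : ContDiff ℝ ∞ (deriv p) := (contDiff_infty_iff_deriv.1 hp.smooth).2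
  have hγ' : ContDiff ℝ ∞ (deriv γ) := (contDiff_infty_iff_deriv.1 hγ.smooth).2
  have hθ' : ContDiff ℝ ∞ (deriv θ) := (contDiff_infty_iff_deriv.1 hγ.smooth_angle).2
  have hθ := hγ.smooth_angle
  have hpθ : ContDiff ℝ ∞ (fun t => deriv p (θ t)) := hp'.comp hθ
  have hc : ContDiff ℝ ∞ (fun t => cos (θ t)) := contDiff_cos.comp hθ
  have hs : ContDiff ℝ ∞ (fun t => sin (θ t)) := contDiff_sin.comp hθ
  have hne (t : ℝ) : ((deriv p (θ t)).1 * cos (θ t) + (deriv p (θ t)).2 * sin (θ t)) *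
      deriv θ t ≠ 0 := by
    obtain ⟨ρ, hρ, h⟩ := hp.tangent (θ t)
    refine mul_ne_zero ?_ (hγ.angle_deriv_ne_zero t)
    rw [h]
    simp only [dir, Prod.smul_mk, smul_eq_mul]
    rw [show ρ * cos (θ t) * cos (θ t) + ρ * sin (θ t) * sin (θ t) = ρ by
      linear_combination ρ * sin_sq_add_cos_sq (θ t)]
    exact hρ.ne'
  refine ⟨fun t => ((deriv γ t).1 * cos (θ t) + (deriv γ t).2 * sin (θ t)) /
    (((deriv p (θ t)).1 * cos (θ t) + (deriv p (θ t)).2 * sin (θ t)) * deriv θ t),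
    ((hγ'.fst.mul hc).add (hγ'.snd.mul hs)).div
      (((hpθ.fst.mul hc).add (hpθ.snd.mul hs)).mul hθ') hne, fun t => ?_⟩
  have hd : deriv (fun s => p (θ s)) t = deriv θ t • deriv p (θ t) :=
    ((hp.hasDerivAt (θ t)).scomp t (hθ.differentiable (by simp) t).hasDerivAt).deriv
  have h1 := hne t
  have hl := hγ.legendrian t
  obtain ⟨ρ, hρ, h⟩ := hp.tangent (θ t)
  have h3 := sin_sq_add_cos_sq (θ t)
  rw [hd, smul_smul]
  simp only [h] at h1 ⊢
  have h2 := hγ.angle_deriv_ne_zero t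
  simp only [det, dir, Prod.smul_mk, smul_eq_mul] at h1 hl ⊢
  rw [show ρ * cos (θ t) * cos (θ t) + ρ * sin (θ t) * sin (θ t) = ρ by
      linear_combination ρ * h3]
  have h4 : ρ ≠ 0 := hρ.ne'
  ext
  · simp only
    field_simp
    linear_combination (-(deriv γ t).1) * h3 - sin (θ t) * hl
  · simp only
    field_simp
    linear_combination (-(deriv γ t).2) * h3 + cos (θ t) * hl

end NormedPlane

/-! ### Transfer from the tangent angle to the given parameter -/

open Real Set NormedPlane in
theorem mainTheorem9 (N : Seminorm ℝ (ℝ × ℝ)) (p : ℝ → ℝ × ℝ)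
    (hp : NormedPlane.IsUnitCircle N p)
    (γ : ℝ → ℝ × ℝ) (θ : ℝ → ℝ) (T : ℝ)
    (hγ : NormedPlane.IsClosedFront γ θ T)
    (hw : NormedPlane.HasConstantWidth p γ θ) :
    ∃ r : ℝ → ℝ, ContDiff ℝ ∞ r ∧ NormedPlane.IsCurvatureRadius p γ θ r ∧
      6 ≤ (NormedPlane.vertices r T).encard := by
  obtain ⟨r, hr, hrc⟩ := hγ.toIsFront.exists_curvatureRadius hp
  refine ⟨r, hr, hrc, ?_⟩
  have hθd : Differentiable ℝ θ := hγ.smooth_angle.differentiable (by simp)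
  have h0 := hγ.angle_deriv_ne_zero
  have hT := hγ.period_pos
  obtain ⟨n, hn, hturn⟩ := exists_turning_sign hθd.continuous (injective_of_deriv_ne_zero hθd h0)
    hT hγ.one_turn
  have hn0 : (n : ℝ) ≠ 0 := by rcases hn with rfl | rfl <;> norm_num
  obtain ⟨ψ, hψθ, hθψ, hψc, hψd⟩ := exists_smooth_inverse hγ.smooth_angle h0
    (surjective_of_add_eq hθd.continuous (mul_ne_zero hn0 two_pi_pos.ne') hturn)
  obtain ⟨c, hc⟩ := hw
  have hrd (t : ℝ) : HasDerivAt r (deriv r t) t := (hr.differentiable (by simp) t).hasDerivAt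
  have hΓ (x : ℝ) : HasDerivAt (fun x => γ (ψ x)) (r (ψ x) • deriv p x) x := by
    have h1 : HasDerivAt γ (deriv γ (ψ x)) (ψ x) :=
      (hγ.smooth.differentiable (by simp) _).hasDerivAt
    refine (h1.scomp x (hψd x)).congr_deriv ?_
    have h2 : deriv (fun s => p (θ s)) (ψ x) = deriv θ (ψ x) • deriv p (θ (ψ x)) :=
      ((hp.hasDerivAt _).scomp (ψ x) (hθd _).hasDerivAt).deriv
    rw [hrc, h2, hθψ, smul_comm, smul_smul, smul_smul, mul_assoc,
      inv_mul_cancel₀ (h0 _), mul_one]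
  have hR (x : ℝ) : HasDerivAt (fun x => r (ψ x)) (deriv r (ψ x) * (deriv θ (ψ x))⁻¹) x :=
    (hrd (ψ x)).comp x (hψd x)
  have hsub := sub_antipode_eq hp hΓ (c := c) (fun x => by
    have := hc (ψ x) (ψ (x + π)) (by rw [hθψ, hθψ])
    simpa only [supportFunction, hθψ] using this)
  have hsum := radius_add_radius_eq hp hΓ hsub
  have hcont : Continuous fun x => deriv r (ψ x) * (deriv θ (ψ x))⁻¹ :=
    (((contDiff_infty_iff_deriv.1 hr).2.continuous).comp hψc).mul
      ((((contDiff_infty_iff_deriv.1 hγ.smooth_angle).2.continuous).comp hψc).inv₀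
        fun x => h0 _)
  obtain ⟨a, ha⟩ := exists_six_zeros hcont (radius_deriv_antiperiodic hR hsum)
    (halfTurnOrthogonal_radius_deriv hp hΓ hR hsub)
  -- Two half turns replace `R` by `c - (c - R)`.
  have hRper (x : ℝ) : r (ψ (x + 2 * π)) = r (ψ x) := by
    have h1 := hsum x
    have h2 := hsum (x + π)
    rw [add_assoc, ← two_mul] at h2
    linarith
  have hrper : Function.Periodic r T := by
    intro t
    have h1 : r (ψ (θ t + n * (2 * π))) = r (ψ (θ t)) :=
      Function.Periodic.int_mul (f := fun x => r (ψ x)) hRper n (θ t)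
    rwa [← hturn, hψθ, hψθ] at h1
  have hdper : Function.Periodic (deriv r) T := by
    intro t
    rw [← deriv_comp_add_const, funext hrper]
  -- Reducing `θ` modulo `2π` into `[a, a + 2π)` maps the vertices in `[0, T)` onto a set containing
  -- all the zeros found, so there are at least as many vertices.
  refine ha.trans (le_trans (Set.encard_le_encard ?_)
    (Set.encard_image_le (fun t => toIcoMod two_pi_pos a (θ t)) _))
  rintro x ⟨hx, hx0⟩
  refine ⟨toIcoMod hT 0 (ψ x), ⟨by simpa using toIcoMod_mem_Ico hT 0 (ψ x), ?_⟩, ?_⟩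
  · have h1 : deriv r (ψ x) = 0 := (mul_eq_zero.1 hx0).resolve_right (inv_ne_zero (h0 _))
    rw [toIcoMod, hdper.sub_zsmul_eq, h1]
  -- Moving `ψ x` into `[0, T)` by whole periods changes the angle by a multiple of `2π`, so
  -- reduction returns `x`.
  · have h1 := angle_add_zsmul hturn (-toIcoDiv hT 0 (ψ x)) (ψ x)
    have h2 : toIcoMod hT 0 (ψ x) = ψ x + ((-toIcoDiv hT 0 (ψ x) : ℤ) : ℝ) * T := by
      rw [toIcoMod, zsmul_eq_mul]; push_cast; ring
    simp only
    rw [h2, h1, hθψ, ← mul_assoc, ← Int.cast_mul, ← zsmul_eq_mul, toIcoMod_add_zsmul,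
      (toIcoMod_eq_self two_pi_pos).2 hx]
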